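/- An I-topological system is a triple $(X,\models,A)$ consisting of a nonempty set $X$, a Heyting algebra $A$ and a relation $\models$ from $X$ to $A$ such that, for all $x\in X$ and $a,b\in A$: (1) $x\not\models \mathbf{0}$; (2) $x\models a\wedge b$ iff $x\models a$ and $x\models b$; (3) $x\models a\vee b$ iff $x\models a$ or $x\models b$; (4) $x\models a\rightarrow b$ iff for every $y\in X$ with $p^*(x)\le p^*(y)$ pointwise, $y\not\models a$ or $y\models b$; here $p^*(x):A\to\{0,1\}$ is given by $p^*(x)(a)=1$ iff $x\models a$. Each $p^*(x)$ is then a bounded lattice homomorphism, and the system is called Heyting algebraic if $p^*$ is a bijection from $X$ onto the set $\mathrm{Hom}(A,\{0,1\})$ of all bounded lattice homomorphisms $A\to\{0,1\}$. A morphism $(X,\models,A)\to(Y,\models',B)$ is a pair $(f_1,f_2)$ of a map $f_1:X\to Y$ and a Heyting homomorphism $f_2:B\to A$ with $x\models f_2(b)$ iff $f_1(x)\models' b$ for all $x\in X$, $b\in B$; identities are $(\mathrm{id}_X,\mathrm{id}_A)$ and $(g_1,g_2)\circ(f_1,f_2)=(g_1\circ f_1,f_2\circ g_2)$. Let $\mathbf{HI\text{-}TopSys}$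 be the category of Heyting algebraic I-topological systems and all these morphisms between them. An Esakia space is a nonempty partially ordered set $(X,\le)$ with a compact topology such that whenever $x\not\le y$ there is a clopen up-set $U$ with $x\in U$, $y\notin U$, and such that the down-set $\downarrow U$ of every clopen set $U$ is clopen. An Esakia morphism $f:X\to Y$ is a continuous order-preserving map such that whenever $f(x)\le y$ there is $z\ge x$ with $f(z)=y$. Let $\mathbf{ESA}$ be the category of (nonempty) Esakia spaces and Esakia morphisms. Theorem. The category $\mathbf{HI\text{-}TopSys}$ is equivalent to the category $\mathbf{ESA}$. -/

import Mathlib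

open CategoryTheory

universe u

/-- The `{0,1}`-valued function `p*(x)` attached to a point `x` by a relation `⊨` from `X` to `A`:
`p*(x)(a) = 1` iff `x ⊨ a`. The two-element Heyting algebra `{0,1}` is `Bool`. -/
noncomputable def satVal {X A : Type u} (sat : X → A → Prop) (x : X) (a : A) : Bool :=
  @decide (sat x a) (Classical.propDecidable _)

theorem satVal_eq_true {X A : Type u} (sat : X → A → Prop) (x : X) (a : A) :
    satVal sat x a = true ↔ sat x a := by
  unfold satVal
  exact @decide_eq_true_iff (sat x a) (Classical.propDecidable _)

/-- I-topological systems `(X, ⊨, A)`. In `sat_himp`, the relation `p*(x) R p*(y)` is the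
pointwise order of `{0,1}`-valued functions. -/
structure ITopSys where
  pt : Type u
  alg : Type u
  [nonempty_pt : Nonempty pt]
  [heyting : HeytingAlgebra alg]
  sat : pt → alg → Prop
  not_sat_bot : ∀ x, ¬ sat x ⊥
  sat_inf : ∀ x a b, sat x (a ⊓ b) ↔ sat x a ∧ sat x b
  sat_sup : ∀ x a b, sat x (a ⊔ b) ↔ sat x a ∨ sat x b
  sat_himp : ∀ x a b, sat x (a ⇨ b) ↔
    ∀ y, (∀ c, satVal sat x c ≤ satVal sat y c) → ¬ sat y a ∨ sat y b

attribute [instance] ITopSys.nonempty_pt ITopSys.heyting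

namespace ITopSys

theorem sat_top (S : ITopSys.{u}) (x : S.pt) : S.sat x ⊤ := by
  have h := (S.sat_himp x ⊥ ⊥).2 fun y _ => Or.inl (S.not_sat_bot y)
  rwa [himp_self] at h

/-- The map `p* : X → Hom(A, {0,1})` into the bounded lattice homomorphisms,
`p*(x)(a) = 1` iff `x ⊨ a`. -/
noncomputable def pStar (S : ITopSys.{u}) (x : S.pt) : BoundedLatticeHom S.alg Bool where
  toFun := satVal S.sat x
  map_sup' a b := by
    rw [Bool.eq_iff_iff]
    simp [satVal_eq_true, S.sat_sup]
  map_inf' a b := by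
    rw [Bool.eq_iff_iff]
    simp [satVal_eq_true, S.sat_inf]
  map_top' := (satVal_eq_true _ _ _).2 (S.sat_top x)
  map_bot' := by
    rw [Bool.eq_iff_iff]
    simp [satVal_eq_true, S.not_sat_bot]

/-- Morphisms `(f₁, f₂) : (X, ⊨, A) ⟶ (Y, ⊨', B)`: a map `f₁ : X → Y` and a Heyting homomorphism
`f₂ : B → A` with `x ⊨ f₂ b` iff `f₁ x ⊨' b`. -/
@[ext]
structure Hom (S T : ITopSys.{u}) where
  onPt : S.pt → T.pt
  onAlg : HeytingHom T.alg S.alg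
  sat_iff : ∀ x b, S.sat x (onAlg b) ↔ T.sat (onPt x) b

instance : Category ITopSys.{u} where
  Hom S T := Hom S T
  id S := ⟨id, HeytingHom.id S.alg, fun _ _ => Iff.rfl⟩
  comp f g := ⟨g.onPt ∘ f.onPt, f.onAlg.comp g.onAlg,
    fun x c => (f.sat_iff x (g.onAlg c)).trans (g.sat_iff (f.onPt x) c)⟩

/-- An I-topological system is Heyting algebraic if `p*` is a bijection. -/
def IsHeytingAlgebraic : ObjectProperty ITopSys.{u} := fun S => Function.Bijective S.pStar

end ITopSys

/-- Heyting algebraic I-topological systems: a full subcategory of `ITopSys`. -/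
abbrev HITopSys := ITopSys.IsHeytingAlgebraic.{u}.FullSubcategory

/-- Nonempty Esakia spaces: compact partially ordered spaces with the Priestley separation property,
in which the down-set of every clopen set is clopen. -/
structure Esa where
  carrier : Type u
  [top : TopologicalSpace carrier]
  [order : PartialOrder carrier]
  [nonempty : Nonempty carrier]
  [compact : CompactSpace carrier]
  [priestley : PriestleySpace carrier]
  isClopen_lowerClosure : ∀ U : Set carrier, IsClopen U → IsClopen (lowerClosure U : Set carrier)

attribute [instance] Esa.top Esa.order Esa.nonempty Esa.compact Esa.priestley

namespace Esa

/-- Morphisms are Esakia morphisms: continuous monotone maps `f` such that `f x ≤ y` implies that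
there is `z ≥ x` with `f z = y`. -/
@[ext]
structure Hom (X Y : Esa.{u}) where
  hom : EsakiaHom X.carrier Y.carrier

instance : Category Esa.{u} where
  Hom X Y := Hom X Y
  id X := ⟨EsakiaHom.id X.carrier⟩
  comp f g := ⟨g.hom.comp f.hom⟩

end Esa

/-! This is Esakia duality. In a Heyting algebraic system the points are the prime spectrum of `A`:
order them by inclusion of the sets of satisfied elements and topologise them as a subspace of
`{0,1}^A`. Then `extent` identifies `A` with the clopen up-sets: it is injective by prime separation
(`le_of_extent_subset`) and surjective by compactness (`exists_extent_eq`). Forgetting `A` is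
therefore a functor to Esakia spaces. It is faithful because extents determine `f₂`, full because
preimages of clopen up-sets are clopen up-sets, and essentially surjective because an Esakia space
with its clopen up-sets is such a system. -/

open Set Order

/-! ### Prime separation in distributive lattices -/

section Lattice

variable {A : Type*} [DistribLattice A] [BoundedOrder A]

/-- The bounded lattice homomorphism to `Bool` whose kernel is a prime ideal. -/
noncomputable def Order.Ideal.IsPrime.toBoolHom {J : Ideal A} (hJ : J.IsPrime) :
    BoundedLatticeHom A Bool where
  toFun a := @decide (a ∉ J) (Classical.propDecidable _)
  map_sup' a b := by
    rw [Bool.eq_iff_iff]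
    simp only [decide_eq_true_eq, Bool.max_eq_or, Bool.or_eq_true, Ideal.sup_mem_iff]
    tauto
  map_inf' a b := by
    rw [Bool.eq_iff_iff]
    simp only [decide_eq_true_eq, Bool.min_eq_and, Bool.and_eq_true]
    refine ⟨fun h => ⟨fun ha => h (J.lower inf_le_left ha), fun hb => h (J.lower inf_le_right hb)⟩,
      fun h hab => (hJ.mem_or_mem hab).elim h.1 h.2⟩
  map_top' := by
    simpa using Ideal.IsProper.top_notMem hJ.toIsProper
  map_bot' := by
    simp

theorem Order.Ideal.IsPrime.toBoolHom_eq_true {J : Ideal A} (hJ : J.IsPrime) (a : A) :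
    hJ.toBoolHom a = true ↔ a ∉ J :=
  @decide_eq_true_iff _ (Classical.propDecidable _)

/-- Prime separation: a meet-closed set and a join-closed set with no element of the first below
an element of the second are separated by a homomorphism to `Bool`. -/
theorem exists_boolHom_separating {F I : Set A} (hF : F.Nonempty) (hFi : InfClosed F)
    (hI : I.Nonempty) (hIs : SupClosed I) (hFI : ∀ a ∈ F, ∀ b ∈ I, ¬ a ≤ b) :
    ∃ h : BoundedLatticeHom A Bool, (∀ a ∈ F, h a = true) ∧ ∀ b ∈ I, ¬ h b = true := by
  have hF' : IsPFilter (upperClosure F : Set A) := by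
    refine IsPFilter.of_def (hF.mono subset_upperClosure) ?_
      (fun {x y} hxy hx => (upperClosure F).upper hxy hx)
    rintro x ⟨a, ha, hax⟩ y ⟨b, hb, hby⟩
    exact ⟨a ⊓ b, ⟨a ⊓ b, hFi ha hb, le_rfl⟩, inf_le_left.trans hax, inf_le_right.trans hby⟩
  have hI' : IsIdeal (lowerClosure I : Set A) := by
    refine ⟨(lowerClosure I).lower, hI.mono subset_lowerClosure, ?_⟩
    rintro x ⟨a, ha, hax⟩ y ⟨b, hb, hby⟩
    exact ⟨a ⊔ b, ⟨a ⊔ b, hIs ha hb, le_rfl⟩, hax.trans le_sup_left, hby.trans le_sup_right⟩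
  have hdis : Disjoint (hF'.toPFilter : Set A) (hI'.toIdeal : Set A) := by
    refine Set.disjoint_left.2 ?_
    rintro x ⟨a, ha, hax⟩ ⟨b, hb, hxb⟩
    exact hFI a ha b hb (le_trans hax hxb)
  obtain ⟨J, hJ, hIJ, hFJ⟩ := DistribLattice.prime_ideal_of_disjoint_filter_ideal hdis
  refine ⟨hJ.toBoolHom, fun a ha => ?_, fun b hb => ?_⟩
  · rw [hJ.toBoolHom_eq_true]
    exact Set.disjoint_left.1 hFJ (subset_upperClosure ha)
  · rw [hJ.toBoolHom_eq_true, not_not]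
    exact hIJ (subset_lowerClosure hb)

end Lattice

/-! ### Two compactness arguments -/

section Compact

variable {X : Type*} [TopologicalSpace X]

/-- In a compact space, a point is separated from a closed set by a member of an
intersection-closed family of closed sets as soon as it is separated from each of its points. -/
theorem IsOpen.exists_mem_subset_of_separating [CompactSpace X] {B : Set (Set X)} {K : Set X}
    (hK : IsOpen K) (hB : ∀ s ∈ B, IsClosed s) (huniv : univ ∈ B) (hinf : InfClosed B) {x : X}
    (hsep : ∀ y ∉ K, ∃ s ∈ B, x ∈ s ∧ y ∉ s) : ∃ s ∈ B, x ∈ s ∧ s ⊆ K := by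
  have key : ∃ s ∈ B, x ∈ s ∧ Kᶜ ⊆ sᶜ := by
    refine hK.isClosed_compl.isCompact.induction_on (p := fun V => ∃ s ∈ B, x ∈ s ∧ V ⊆ sᶜ)
      ⟨univ, huniv, mem_univ x, empty_subset _⟩ ?_ ?_ ?_
    · rintro V W hVW ⟨s, hs, hx, hW⟩
      exact ⟨s, hs, hx, hVW.trans hW⟩
    · rintro V W ⟨s, hs, hxs, hV⟩ ⟨t, ht, hxt, hW⟩
      refine ⟨s ∩ t, hinf hs ht, ⟨hxs, hxt⟩, ?_⟩
      rw [compl_inter]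
      exact union_subset_union hV hW
    · intro y hy
      obtain ⟨s, hs, hx, hys⟩ := hsep y hy
      exact ⟨sᶜ, mem_nhdsWithin_of_mem_nhds ((hB s hs).isOpen_compl.mem_nhds hys), s, hs, hx,
        subset_rfl⟩
  obtain ⟨s, hs, hx, h⟩ := key
  exact ⟨s, hs, hx, compl_subset_compl.1 h⟩

/-- A compact set that is locally a union of members of a union-closed family of open sets belongs
to that family. -/
theorem IsCompact.mem_of_forall_exists_subset {B : Set (Set X)} {K : Set X} (hK : IsCompact K)
    (hB : ∀ s ∈ B, IsOpen s) (hempty : ∅ ∈ B) (hsup : SupClosed B)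
    (h : ∀ x ∈ K, ∃ s ∈ B, x ∈ s ∧ s ⊆ K) : K ∈ B := by
  have key : ∃ s ∈ B, K ⊆ s ∧ s ⊆ K := by
    refine hK.induction_on (p := fun V => ∃ s ∈ B, V ⊆ s ∧ s ⊆ K)
      ⟨∅, hempty, subset_rfl, empty_subset _⟩ ?_ ?_ ?_
    · rintro V W hVW ⟨s, hs, hW, hsK⟩
      exact ⟨s, hs, hVW.trans hW, hsK⟩
    · rintro V W ⟨s, hs, hV, hsK⟩ ⟨t, ht, hW, htK⟩
      exact ⟨s ∪ t, hsup hs ht, union_subset_union hV hW, union_subset hsK htK⟩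
    · intro x hx
      obtain ⟨s, hs, hxs, hsK⟩ := h x hx
      exact ⟨s, mem_nhdsWithin_of_mem_nhds ((hB s hs).mem_nhds hxs), s, hs, subset_rfl, hsK⟩
  obtain ⟨s, hs, h₁, h₂⟩ := key
  rwa [h₁.antisymm h₂]

end Compact

/-! ### The Esakia space of points of a system -/

namespace HITopSys

variable (S T : HITopSys.{u})

/-- The points of a Heyting algebraic system, to be ordered and topologised by `⊨`. -/
abbrev Points : Type u := S.obj.pt

variable {S T}

/-- The set of points satisfying `a`. -/
def extent (a : S.obj.alg) : Set S.Points := {x | S.obj.sat x a}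

theorem mem_extent {x : S.Points} {a : S.obj.alg} : x ∈ extent a ↔ S.obj.sat x a := Iff.rfl

theorem eq_of_sat_iff {x y : S.Points} (h : ∀ a, S.obj.sat x a ↔ S.obj.sat y a) : x = y := by
  refine S.property.1 (DFunLike.ext _ _ fun a => ?_)
  rw [Bool.eq_iff_iff]
  exact (satVal_eq_true _ _ _).trans ((h a).trans (satVal_eq_true _ _ _).symm)

instance : PartialOrder S.Points where
  le x y := ∀ a, S.obj.sat x a → S.obj.sat y a
  le_refl _ _ := id
  le_trans _ _ _ h k a := k a ∘ h a
  le_antisymm _ _ h k := eq_of_sat_iff fun a => ⟨h a, k a⟩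

theorem le_def {x y : S.Points} : x ≤ y ↔ ∀ a, S.obj.sat x a → S.obj.sat y a := Iff.rfl

theorem sat_himp_iff {x : S.Points} {a b : S.obj.alg} :
    S.obj.sat x (a ⇨ b) ↔ ∀ y : S.Points, x ≤ y → S.obj.sat y a → S.obj.sat y b := by
  rw [S.obj.sat_himp]
  refine forall_congr' fun y => imp_congr (forall_congr' fun c => ?_) imp_iff_not_or.symm
  rw [Bool.le_iff_imp, satVal_eq_true, satVal_eq_true]

theorem extent_inf (a b : S.obj.alg) : extent (a ⊓ b) = extent a ∩ extent b :=
  Set.ext fun x => S.obj.sat_inf x a b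

theorem extent_sup (a b : S.obj.alg) : extent (a ⊔ b) = extent a ∪ extent b :=
  Set.ext fun x => S.obj.sat_sup x a b

theorem extent_top : extent (⊤ : S.obj.alg) = univ :=
  eq_univ_of_forall S.obj.sat_top

theorem extent_bot : extent (⊥ : S.obj.alg) = ∅ :=
  eq_empty_of_forall_notMem S.obj.not_sat_bot

theorem isUpperSet_extent (a : S.obj.alg) : IsUpperSet (extent a) :=
  fun _ _ h hx => h a hx

/-- Surjectivity of `p*` realises the separating homomorphism as a point. -/
theorem exists_point_separating {F I : Set S.obj.alg} (hF : F.Nonempty) (hFi : InfClosed F)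
    (hI : I.Nonempty) (hIs : SupClosed I) (hFI : ∀ a ∈ F, ∀ b ∈ I, ¬ a ≤ b) :
    ∃ x : S.Points, (∀ a ∈ F, S.obj.sat x a) ∧ ∀ b ∈ I, ¬ S.obj.sat x b := by
  obtain ⟨h, h₁, h₂⟩ := exists_boolHom_separating hF hFi hI hIs hFI
  obtain ⟨x, rfl⟩ := S.property.2 h
  exact ⟨x, fun a ha => (satVal_eq_true _ _ _).1 (h₁ a ha),
    fun b hb hx => h₂ b hb ((satVal_eq_true _ _ _).2 hx)⟩

theorem le_of_extent_subset {a b : S.obj.alg} (h : extent a ⊆ extent b) : a ≤ b := by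
  by_contra hab
  obtain ⟨x, h₁, h₂⟩ := exists_point_separating (S := S) (F := {a}) (I := {b})
    (singleton_nonempty a) infClosed_singleton (singleton_nonempty b) supClosed_singleton
    (by rintro _ rfl _ rfl; exact hab)
  exact h₂ b rfl (h (h₁ a rfl))

theorem extent_injective : Function.Injective (extent : S.obj.alg → Set S.Points) :=
  fun _ _ h => (le_of_extent_subset h.subset).antisymm (le_of_extent_subset h.superset)

noncomputable instance : TopologicalSpace S.Points :=
  TopologicalSpace.induced (fun x (a : S.obj.alg) => S.obj.pStar x a) inferInstance

theorem isInducing_pStar :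
    Topology.IsInducing fun (x : S.Points) (a : S.obj.alg) => S.obj.pStar x a := ⟨rfl⟩

theorem isClopen_extent (a : S.obj.alg) : IsClopen (extent a) := by
  have hc : Continuous fun x : S.Points => S.obj.pStar x a :=
    (continuous_apply a).comp isInducing_pStar.continuous
  have : extent a = (fun x : S.Points => S.obj.pStar x a) ⁻¹' {true} :=
    Set.ext fun x => (satVal_eq_true S.obj.sat x a).symm
  rw [this]
  exact (isClopen_discrete _).preimage hc

theorem continuous_of_isClopen_preimage_extent {X : Type*} [TopologicalSpace X] {f : X → S.Points}
    (h : ∀ a, IsClopen (f ⁻¹' extent a)) : Continuous f := by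
  refine isInducing_pStar.continuous_iff.2 (continuous_pi fun a => ?_)
  refine continuous_bool_rng true |>.2 ?_
  convert h a using 1
  exact Set.ext fun x => satVal_eq_true S.obj.sat (f x) a

/-- Surjectivity of `p*` makes its image the set of all solutions of the homomorphism equations,
which is closed in the compact space `{0,1}^A`. -/
instance : CompactSpace S.Points := by
  have hrange : range (fun (x : S.Points) (a : S.obj.alg) => S.obj.pStar x a) =
      {g | g ⊤ = ⊤ ∧ g ⊥ = ⊥ ∧ ∀ a b, g (a ⊔ b) = g a ⊔ g b ∧ g (a ⊓ b) = g a ⊓ g b} := by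
    ext g
    constructor
    · rintro ⟨x, rfl⟩
      exact ⟨map_top _, map_bot _, fun a b => ⟨map_sup _ a b, map_inf _ a b⟩⟩
    · rintro ⟨htop, hbot, h⟩
      obtain ⟨x, hx⟩ := S.property.2
        { toFun := g, map_sup' := fun a b => (h a b).1, map_inf' := fun a b => (h a b).2,
          map_top' := htop, map_bot' := hbot }
      exact ⟨x, funext fun a => DFunLike.congr_fun hx a⟩
  have hclosed : IsClosed (range fun (x : S.Points) (a : S.obj.alg) => S.obj.pStar x a) := by
    rw [hrange]
    refine (isClosed_eq (continuous_apply _) continuous_const).inter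
      ((isClosed_eq (continuous_apply _) continuous_const).inter ?_)
    change IsClosed {g : S.obj.alg → Bool | ∀ a b, g (a ⊔ b) = g a ⊔ g b ∧ g (a ⊓ b) = g a ⊓ g b}
    simp only [ofPred_forall]
    refine isClosed_iInter fun a => isClosed_iInter fun b => ?_
    have hpair : Continuous fun g : S.obj.alg → Bool => (g a, g b) :=
      (continuous_apply a).prodMk (continuous_apply b)
    exact (isClosed_eq (continuous_apply _)
        ((continuous_of_discreteTopology (f := fun p : Bool × Bool => p.1 ⊔ p.2)).comp hpair)).inter
      (isClosed_eq (continuous_apply _)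
        ((continuous_of_discreteTopology (f := fun p : Bool × Bool => p.1 ⊓ p.2)).comp hpair))
  rw [← isCompact_univ_iff, isInducing_pStar.isCompact_iff, image_univ]
  exact hclosed.isCompact

instance : PriestleySpace S.Points where
  priestley {x y} h := by
    rw [le_def] at h
    push Not at h
    obtain ⟨a, hx, hy⟩ := h
    exact ⟨extent a, isClopen_extent a, isUpperSet_extent a, hx, hy⟩

/-- As `U` is an up-set, `x ∈ U` and `y ∉ U` force `¬ x ≤ y`, so some extent contains `x` but not
`y`. Finite intersections of extents then fit between `x` and `U`, and finitely many of these cover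
`U`. -/
theorem exists_extent_eq {U : Set S.Points} (hU : IsClopen U) (hU' : IsUpperSet U) :
    ∃ a : S.obj.alg, extent a = U := by
  refine hU.isClosed.isCompact.mem_of_forall_exists_subset (B := range (extent (S := S)))
    (by rintro _ ⟨a, rfl⟩; exact (isClopen_extent a).isOpen) ⟨⊥, extent_bot⟩
    (by rintro _ ⟨a, rfl⟩ _ ⟨b, rfl⟩; exact ⟨a ⊔ b, extent_sup a b⟩) fun x hx => ?_
  refine hU.isOpen.exists_mem_subset_of_separating (B := range (extent (S := S)))
    (by rintro _ ⟨a, rfl⟩; exact (isClopen_extent a).isClosed) ⟨⊤, extent_top⟩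
    (by rintro _ ⟨a, rfl⟩ _ ⟨b, rfl⟩; exact ⟨a ⊓ b, extent_inf a b⟩) fun y hy => ?_
  have h : ¬ x ≤ y := fun h => hy (hU' h hx)
  rw [le_def] at h
  push Not at h
  obtain ⟨a, hxa, hya⟩ := h
  exact ⟨extent a, ⟨a, rfl⟩, hxa, hya⟩

/-- The axiom for `⇨` in topological form: the source of the Esakia condition. -/
theorem lowerClosure_extent_diff (a b : S.obj.alg) :
    (lowerClosure (extent a \ extent b) : Set S.Points) = (extent (a ⇨ b))ᶜ := by
  ext x
  rw [mem_compl_iff, mem_extent, sat_himp_iff, SetLike.mem_coe, mem_lowerClosure]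
  push Not
  exact ⟨fun ⟨y, ⟨ha, hb⟩, hxy⟩ => ⟨y, hxy, ha, hb⟩, fun ⟨y, hxy, ha, hb⟩ => ⟨y, ⟨ha, hb⟩, hxy⟩⟩

/-- Differences of extents form a basis but are not closed under union, so the covering argument
runs over all open sets with clopen down-set; down-sets commute with unions. -/
theorem isClopen_lowerClosure {U : Set S.Points} (hU : IsClopen U) :
    IsClopen (lowerClosure U : Set S.Points) := by
  refine (hU.isClosed.isCompact.mem_of_forall_exists_subset
    (B := {W | IsOpen W ∧ IsClopen (lowerClosure W : Set S.Points)}) (fun _ h => h.1)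
    ⟨isOpen_empty, by simp [isClopen_empty]⟩ (fun V hV W hW => ⟨hV.1.union hW.1, ?_⟩) fun x hx => ?_).2
  · have : (lowerClosure (V ⊔ W) : Set S.Points) =
        (lowerClosure V : Set S.Points) ∪ (lowerClosure W : Set S.Points) := by
      rw [← LowerSet.coe_sup, ← lowerClosure_union]
      rfl
    rw [this]
    exact hV.2.union hW.2
  · suffices h : ∃ s ∈ {s | ∃ a b : S.obj.alg, extent a \ extent b = s}, x ∈ s ∧ s ⊆ U by
      obtain ⟨_, ⟨a, b, rfl⟩, hx, h⟩ := h
      refine ⟨_, ⟨((isClopen_extent a).diff (isClopen_extent b)).isOpen, ?_⟩, hx, h⟩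
      rw [lowerClosure_extent_diff]
      exact (isClopen_extent _).compl
    refine hU.isOpen.exists_mem_subset_of_separating ?_ ?_ ?_ ?_
    · rintro _ ⟨a, b, rfl⟩
      exact ((isClopen_extent a).diff (isClopen_extent b)).isClosed
    · exact ⟨⊤, ⊥, by rw [extent_top, extent_bot, sdiff_empty]⟩
    · rintro _ ⟨a, b, rfl⟩ _ ⟨c, d, rfl⟩
      refine ⟨a ⊓ c, b ⊔ d, ?_⟩
      rw [extent_inf, extent_sup]
      ext y
      simp only [mem_sdiff, mem_inter_iff, mem_union, inf_eq_inter]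
      tauto
    · intro y hy
      have hne : ¬ (∀ a, S.obj.sat x a ↔ S.obj.sat y a) := fun h => hy (eq_of_sat_iff h ▸ hx)
      push Not at hne
      obtain ⟨a, ⟨h₁, h₂⟩ | ⟨h₁, h₂⟩⟩ := hne
      · exact ⟨_, ⟨a, ⊥, rfl⟩, ⟨h₁, S.obj.not_sat_bot x⟩, fun h => h₂ h.1⟩
      · exact ⟨_, ⟨⊤, a, rfl⟩, ⟨S.obj.sat_top x, h₁⟩, fun h => h.2 h₂⟩

variable (S) in
/-- The Esakia space of points of a Heyting algebraic system. -/
noncomputable def toEsa : Esa.{u} where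
  carrier := S.Points
  isClopen_lowerClosure _ := isClopen_lowerClosure

/-! ### The functor to Esakia spaces is fully faithful -/

/-- The map on points underlying a morphism of systems. -/
def pointMap (f : S ⟶ T) : S.Points → T.Points := ITopSys.Hom.onPt f.hom

/-- The Heyting homomorphism underlying a morphism of systems. -/
def algMap (f : S ⟶ T) : HeytingHom T.obj.alg S.obj.alg := ITopSys.Hom.onAlg f.hom

theorem sat_algMap (f : S ⟶ T) (x : S.Points) (b : T.obj.alg) :
    S.obj.sat x (algMap f b) ↔ T.obj.sat (pointMap f x) b :=
  ITopSys.Hom.sat_iff f.hom x b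

/-- The point `z` must satisfy everything `x` does and pull back along `f₂` to exactly what `y`
satisfies. Separation fails only if `a ⊓ f₂ b ≤ f₂ c`, that is `a ≤ f₂ (b ⇨ c)`; then `f₁ x`
satisfies `b ⇨ c`, and `f₁ x ≤ y` contradicts the choice of `b` and `c`. -/
theorem pointMap_exists_of_le (f : S ⟶ T) {x : S.Points} {y : T.Points} (h : pointMap f x ≤ y) :
    ∃ z, x ≤ z ∧ pointMap f z = y := by
  obtain ⟨z, h₁, h₂⟩ := exists_point_separating (S := S)
    (F := {d | ∃ a b, S.obj.sat x a ∧ T.obj.sat y b ∧ a ⊓ algMap f b = d})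
    (I := {d | ∃ c, ¬ T.obj.sat y c ∧ algMap f c = d})
    ⟨_, ⊤, ⊤, S.obj.sat_top x, T.obj.sat_top y, rfl⟩
    (by
      rintro _ ⟨a, b, ha, hb, rfl⟩ _ ⟨a', b', ha', hb', rfl⟩
      refine ⟨a ⊓ a', b ⊓ b', (S.obj.sat_inf _ _ _).2 ⟨ha, ha'⟩,
        (T.obj.sat_inf _ _ _).2 ⟨hb, hb'⟩, ?_⟩
      rw [map_inf, inf_inf_inf_comm])
    ⟨_, ⊥, T.obj.not_sat_bot y, rfl⟩
    (by
      rintro _ ⟨c, hc, rfl⟩ _ ⟨c', hc', rfl⟩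
      exact ⟨c ⊔ c', fun h => ((T.obj.sat_sup _ _ _).1 h).elim hc hc', map_sup _ _ _⟩)
    (by
      rintro _ ⟨a, b, ha, hb, rfl⟩ _ ⟨c, hc, rfl⟩ hle
      rw [← le_himp_iff, ← map_himp] at hle
      have hx : S.obj.sat x (algMap f (b ⇨ c)) := by
        rw [← inf_eq_left.2 hle, S.obj.sat_inf] at ha
        exact ha.2
      exact hc (sat_himp_iff.1 ((sat_algMap f x _).1 hx) y h hb))
  refine ⟨z, fun a ha => ?_, eq_of_sat_iff fun b => ⟨fun hb => ?_, fun hb => ?_⟩⟩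
  · exact ((S.obj.sat_inf _ _ _).1 (h₁ _ ⟨a, ⊤, ha, T.obj.sat_top y, rfl⟩)).1
  · by_contra hy
    exact h₂ _ ⟨b, hy, rfl⟩ ((sat_algMap f z b).2 hb)
  · exact (sat_algMap f z b).1
      ((S.obj.sat_inf _ _ _).1 (h₁ _ ⟨⊤, b, S.obj.sat_top x, hb, rfl⟩)).2

/-- The Esakia morphism between spaces of points induced by a morphism of systems. -/
noncomputable def toEsakiaHom (f : S ⟶ T) : EsakiaHom S.Points T.Points where
  toFun := pointMap f
  monotone' x y h b hb := (sat_algMap f y b).1 (h _ ((sat_algMap f x b).2 hb))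
  continuous_toFun := continuous_of_isClopen_preimage_extent fun b => by
    convert isClopen_extent (algMap f b) using 1
    exact Set.ext fun x => (sat_algMap f x b).symm
  exists_map_eq_of_map_le' _ _ := pointMap_exists_of_le f

/-- The functor sending a Heyting algebraic system to its space of points. -/
noncomputable def pointsFunctor : HITopSys.{u} ⥤ Esa.{u} where
  obj := toEsa
  map f := ⟨toEsakiaHom f⟩

instance : pointsFunctor.{u}.Faithful where
  map_injective {S T f g} h := by
    have hp : pointMap f = pointMap g :=
      congrArg (fun k : Esa.Hom _ _ => (k.hom : S.Points → T.Points)) h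
    refine ObjectProperty.hom_ext _ (ITopSys.Hom.ext hp (DFunLike.ext _ _ fun b => ?_))
    refine extent_injective (Set.ext fun x => ?_)
    exact (sat_algMap f x b).trans ((by rw [hp] : T.obj.sat (pointMap f x) b ↔ _).trans (sat_algMap g x b).symm)

theorem exists_extent_eq_preimage (f : EsakiaHom S.Points T.Points) (b : T.obj.alg) :
    ∃ a : S.obj.alg, extent a = f ⁻¹' extent b :=
  exists_extent_eq ((isClopen_extent b).preimage f.continuous_toFun)
    ((isUpperSet_extent b).preimage f.monotone')

/-- The element whose extent is the preimage of the extent of `b`. -/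
noncomputable def dualFun (f : EsakiaHom S.Points T.Points) (b : T.obj.alg) : S.obj.alg :=
  (exists_extent_eq_preimage f b).choose

theorem dualFun_spec (f : EsakiaHom S.Points T.Points) (b : T.obj.alg) :
    extent (dualFun f b) = f ⁻¹' extent b :=
  (exists_extent_eq_preimage f b).choose_spec

/-- The Heyting homomorphism dual to an Esakia morphism between spaces of points. -/
noncomputable def dualHom (f : EsakiaHom S.Points T.Points) :
    HeytingHom T.obj.alg S.obj.alg where
  toFun := dualFun f
  map_sup' a b := extent_injective <| by
    rw [extent_sup, dualFun_spec, dualFun_spec, dualFun_spec, extent_sup, preimage_union]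
  map_inf' a b := extent_injective <| by
    rw [extent_inf, dualFun_spec, dualFun_spec, dualFun_spec, extent_inf, preimage_inter]
  map_bot' := extent_injective <| by
    rw [dualFun_spec, extent_bot, extent_bot, preimage_empty]
  map_himp' a b := extent_injective <| by
    have key (c : T.obj.alg) (x : S.Points) :
        S.obj.sat x (dualFun f c) ↔ T.obj.sat (f x) c :=
      Set.ext_iff.1 (dualFun_spec f c) x
    ext x
    rw [mem_extent, mem_extent, key, sat_himp_iff, sat_himp_iff]
    simp only [key]
    -- Monotonicity gives one direction; the lifting property of Esakia morphisms gives the other.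
    refine ⟨fun h y hxy => h _ (f.monotone' hxy), fun h y hxy => ?_⟩
    obtain ⟨z, hxz, rfl⟩ := f.exists_map_eq_of_map_le' hxy
    exact h z hxz

theorem sat_dualHom (f : EsakiaHom S.Points T.Points) (x : S.Points) (b : T.obj.alg) :
    S.obj.sat x (dualHom f b) ↔ T.obj.sat (f x) b :=
  Set.ext_iff.1 (dualFun_spec f b) x

instance : pointsFunctor.{u}.Full where
  map_surjective {S T} f :=
    ⟨ObjectProperty.homMk (ITopSys.Hom.mk (S := S.obj) (T := T.obj)
      (Esa.Hom.hom f : S.Points → T.Points) (dualHom (Esa.Hom.hom f))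
      (sat_dualHom (Esa.Hom.hom f))), rfl⟩

end HITopSys

/-! ### Every Esakia space comes from a system -/

namespace Esa

variable (X : Esa.{u})

/-- The Heyting implication of clopen up-sets of an Esakia space. -/
def himp (U V : ClopenUpperSet X.carrier) : ClopenUpperSet X.carrier where
  carrier := (lowerClosure (U \ V : Set X.carrier) : Set X.carrier)ᶜ
  isClopen' := (X.isClopen_lowerClosure _ (U.isClopen.diff V.isClopen)).compl
  upper' := (lowerClosure (U \ V : Set X.carrier)).lower.compl

variable {X}

theorem mem_himp {U V : ClopenUpperSet X.carrier} {x : X.carrier} :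
    x ∈ X.himp U V ↔ ∀ y, x ≤ y → y ∈ U → y ∈ V := by
  change x ∉ lowerClosure (U \ V : Set X.carrier) ↔ _
  rw [mem_lowerClosure]
  push Not
  exact ⟨fun h y hxy hU => by_contra fun hV => h y ⟨hU, hV⟩ hxy,
    fun h y hy hxy => hy.2 (h y hxy hy.1)⟩

instance : HeytingAlgebra (ClopenUpperSet X.carrier) where
  himp := X.himp
  le_himp_iff U V W := by
    refine ⟨fun h x hx => mem_himp.1 (h hx.1) x le_rfl hx.2, fun h x hx => mem_himp.2 ?_⟩
    exact fun y hxy hV => h ⟨U.upper hxy hx, hV⟩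
  compl U := X.himp U ⊥
  himp_bot _ := rfl

theorem le_iff_forall_clopenUpperSet {x y : X.carrier} :
    x ≤ y ↔ ∀ U : ClopenUpperSet X.carrier, x ∈ U → y ∈ U := by
  refine ⟨fun h U => U.upper h, fun h => by_contra fun hxy => ?_⟩
  obtain ⟨U, hU, hU', hx, hy⟩ := exists_isClopen_upper_of_not_le hxy
  exact hy (h ⟨⟨U, hU⟩, hU'⟩ hx)

variable (X) in
/-- The system of points and clopen up-sets of an Esakia space. -/
def toITopSys : ITopSys.{u} where
  pt := X.carrier
  alg := ClopenUpperSet X.carrier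
  sat x U := x ∈ U
  not_sat_bot _ := id
  sat_inf _ _ _ := Iff.rfl
  sat_sup _ _ _ := Iff.rfl
  sat_himp x U V := by
    refine mem_himp.trans (forall_congr' fun y => imp_congr ?_ imp_iff_not_or)
    rw [le_iff_forall_clopenUpperSet]
    refine forall_congr' fun W => ?_
    rw [Bool.le_iff_imp, satVal_eq_true, satVal_eq_true]

/-- The sets `U \ V` with `h U = true` and `h V = false` are closed, directed, and nonempty since
`h` is monotone, so compactness gives a common point. The pairs `(U, ⊥)` and `(⊤, U)` show that it
induces `h`. -/
theorem exists_mem_iff_boolHom (h : BoundedLatticeHom (ClopenUpperSet X.carrier) Bool) :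
    ∃ x : X.carrier, ∀ U, x ∈ U ↔ h U = true := by
  let ι := {p : ClopenUpperSet X.carrier × ClopenUpperSet X.carrier // h p.1 = true ∧ h p.2 = false}
  let t : ι → Set X.carrier := fun p => (p.1.1 : Set X.carrier) \ p.1.2
  have hcl (p : ι) : IsClosed (t p) := (p.1.1.isClopen.diff p.1.2.isClopen).isClosed
  have : Nonempty ι := ⟨⟨(⊤, ⊥), map_top h, map_bot h⟩⟩
  obtain ⟨x, hx⟩ := IsCompact.nonempty_iInter_of_directed_nonempty_isCompact_isClosed t
    (fun p q => ⟨⟨(p.1.1 ⊓ q.1.1, p.1.2 ⊔ q.1.2), by simp [p.2.1, q.2.1], by simp [p.2.2, q.2.2]⟩,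
      fun x hx => ⟨hx.1.1, fun h => hx.2 (Or.inl h)⟩,
      fun x hx => ⟨hx.1.2, fun h => hx.2 (Or.inr h)⟩⟩)
    (fun p => by
      by_contra hne
      rw [not_nonempty_iff_eq_empty, sdiff_eq_empty] at hne
      have hle := OrderHomClass.mono h (show p.1.1 ≤ p.1.2 from hne)
      rw [p.2.1, p.2.2] at hle
      exact absurd hle (by decide))
    (fun p => (hcl p).isCompact) hcl
  rw [mem_iInter] at hx
  refine ⟨x, fun U => ⟨fun hU => ?_, fun hU => (hx ⟨(U, ⊥), hU, map_bot h⟩).1⟩⟩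
  by_contra hne
  exact (hx ⟨(⊤, U), map_top h, by simpa using hne⟩).2 hU

variable (X) in
theorem isHeytingAlgebraic_toITopSys : ITopSys.IsHeytingAlgebraic X.toITopSys := by
  have key (x : X.carrier) (U : ClopenUpperSet X.carrier) :
      X.toITopSys.pStar x U = true ↔ x ∈ U := satVal_eq_true X.toITopSys.sat x U
  refine ⟨fun (x y : X.carrier) h => ?_, fun h => ?_⟩
  · have hxy (U : ClopenUpperSet X.carrier) : x ∈ U ↔ y ∈ U := by rw [← key x, h, key]
    exact le_antisymm (α := X.carrier) (le_iff_forall_clopenUpperSet.2 fun U => (hxy U).1)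
      (le_iff_forall_clopenUpperSet.2 fun U => (hxy U).2)
  · obtain ⟨x, hx⟩ := exists_mem_iff_boolHom h
    exact ⟨x, DFunLike.ext _ _ fun U => Bool.eq_iff_iff.2 ((key x U).trans (hx U))⟩

variable (X) in
/-- The Heyting algebraic system of points and clopen up-sets of an Esakia space. -/
def toHITopSys : HITopSys.{u} := ⟨X.toITopSys, X.isHeytingAlgebraic_toITopSys⟩

/-- A homeomorphism that is an order isomorphism is an isomorphism of Esakia spaces. -/
def isoOfHomeomorph {X Y : Esa.{u}} (e : X.carrier ≃ₜ Y.carrier)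
    (he : ∀ x y, e x ≤ e y ↔ x ≤ y) : X ≅ Y where
  hom := Esa.Hom.mk
    { toFun := e
      monotone' := fun x y h => (he x y).2 h
      continuous_toFun := e.continuous
      exists_map_eq_of_map_le' := fun x y h => ⟨e.symm y, by
        rw [← he, e.apply_symm_apply]; exact h, e.apply_symm_apply y⟩ }
  inv := Esa.Hom.mk
    { toFun := e.symm
      monotone' := fun x y h => by
        rw [← he, e.apply_symm_apply, e.apply_symm_apply]; exact h
      continuous_toFun := e.symm.continuous
      exists_map_eq_of_map_le' := fun x y h => ⟨e y, by
        rw [← e.apply_symm_apply x]; exact (he _ _).2 h, e.symm_apply_apply y⟩ }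
  hom_inv_id := Esa.Hom.ext (EsakiaHom.ext e.symm_apply_apply)
  inv_hom_id := Esa.Hom.ext (EsakiaHom.ext e.apply_symm_apply)

variable (X) in
/-- An Esakia space is homeomorphic to the space of points of its system of clopen up-sets. -/
noncomputable def homeomorphPoints : X.carrier ≃ₜ X.toHITopSys.Points :=
  -- The two topologies live on the same set; the identity is a continuous bijection from a compact
  -- space to a Hausdorff one.
  Continuous.homeoOfEquivCompactToT2 (f := Equiv.refl X.carrier)
    (HITopSys.continuous_of_isClopen_preimage_extent (S := X.toHITopSys)
      fun U : ClopenUpperSet X.carrier => U.isClopen)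

instance : HITopSys.pointsFunctor.{u}.EssSurj where
  mem_essImage X := ⟨X.toHITopSys, ⟨(isoOfHomeomorph (Y := X.toHITopSys.toEsa)
    X.homeomorphPoints fun _ _ => le_iff_forall_clopenUpperSet.symm).symm⟩⟩

end Esa

/-- The category of Heyting algebraic I-topological systems is equivalent to the category of
Esakia spaces and Esakia morphisms. -/
theorem mainTheorem3 : Nonempty (HITopSys.{u} ≌ Esa.{u}) := by
  have : HITopSys.pointsFunctor.{u}.IsEquivalence := {}
  exact ⟨HITopSys.pointsFunctor.asEquivalence⟩
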